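/- Let $m\ge 1$ and let $A,B\in\mathbb{R}^{m\times m}$ be symmetric matrices with $A$ nonsingular. A finite family $\{A_i\}_{1\le i\le L}$ of real symmetric $m\times m$ matrices is called TWSD-B (bounded transformation based weakly simultaneously diagonalizable) if there exist matrices $P_k\in\mathrm{SL}_m(\mathbb{R})$ and real diagonal $m\times m$ matrices $D_k^{(1)},\dots,D_k^{(L)}$, for $k\ge 1$, such that $$\lim_{k\to\infty}\ \sum_{i=1}^{L}\bigl\|P_kA_iP_k^{\top}-D_k^{(i)}\bigr\|^2=0$$ and the norms $\|D_k^{(i)}\|$ are bounded uniformly in $k$ and $i$, where $\|\cdot\|$ is the Frobenius norm. (Equivalently, there exist $P_k\in\mathrm{SL}_m(\mathbb{R})$ such that each of the sequences $(P_k^{\top}A_iP_k)_{k\ge1}$, $1\le i\le L$, converges to a diagonal matrix.) Then $\{A,B\}$ is TWSD-B if and only if $A^{-1}B$ has only real eigenvalues, i.e. every complex eigenvalue of $A^{-1}B$ is real. -/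

import Mathlib

noncomputable section

section FrobeniusNorm

open scoped Matrix.Norms.Frobenius

/-- The error function `φ_T(P, D) = ∑ i, ‖P Aᵢ Pᵀ - Dᵢ‖²`, with `‖·‖` the Frobenius norm. -/
def phiT {L m n : ℕ} (A : Fin L → Matrix (Fin m) (Fin m) ℝ)
    (P : Matrix (Fin n) (Fin m) ℝ) (D : Fin L → Matrix (Fin n) (Fin n) ℝ) : ℝ :=
  ∑ i, ‖P * A i * P.transpose - D i‖ ^ 2

/-- A finite family of real `m × m` matrices is bounded transformation based weakly simultaneously
diagonalizable (TWSD-B) if there are `P k ∈ SL_m(ℝ)` and diagonal matrices `D k i`, uniformly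
bounded in Frobenius norm, with `φ_T(P k, D k) → 0`. -/
def IsTWSDB {L m : ℕ} (A : Fin L → Matrix (Fin m) (Fin m) ℝ) : Prop :=
  ∃ (P : ℕ → Matrix.SpecialLinearGroup (Fin m) ℝ) (D : ℕ → Fin L → Matrix (Fin m) (Fin m) ℝ),
    (∀ k i, (D k i).IsDiag) ∧
    Filter.Tendsto (fun k => phiT A (P k).1 (D k)) Filter.atTop (nhds 0) ∧
    ∃ M : ℝ, ∀ k i, ‖D k i‖ ≤ M

end FrobeniusNorm

/-- Every complex eigenvalue of the real matrix `X` is real. -/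
def HasOnlyRealEigenvalues {m : ℕ} (X : Matrix (Fin m) (Fin m) ℝ) : Prop :=
  ∀ z : ℂ, Module.End.HasEigenvalue (Matrix.toLin' (X.map Complex.ofReal)) z → z.im = 0

end

/-! TWSD-B means that the closure of the SL-orbit of (A, B) under congruence contains a diagonal
pair. The polynomial det (zA - B) is constant on the orbit, hence on its closure, and its roots are
the eigenvalues of A⁻¹B. At a diagonal pair (d, e) with all d i ≠ 0 the roots e i / d i are real,
which gives one direction.

Conversely, induct on the size. A real root x gives a real v ≠ 0 with Bv = xAv; make v the first
basis vector. If vᵀAv ≠ 0, one elimination splits v off from both matrices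
(`weaklyDiagonalizable_of_anisotropic`). If vᵀAv = 0, choose a second vector pairing to 1 with v
under A, all remaining ones pairing to 0. Stretching v and shrinking its partner degenerates the
pair to a hyperbolic plane plus a smaller pair, whose roots are still real
(`weaklyDiagonalizable_of_isotropic`). -/

open Matrix Filter Topology

/-- The pencil determinant `det (z A - B)` at a complex number `z`. -/
def pencilDet {ι : Type*} [Fintype ι] [DecidableEq ι] (A B : Matrix ι ι ℝ) (z : ℂ) : ℂ :=
  (z • A.map Complex.ofReal - B.map Complex.ofReal).det

/-- The pair `(A, B)` can be brought arbitrarily close to a fixed pair of diagonal matrices by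
congruences of determinant one. -/
def WeaklyDiagonalizable {ι : Type*} [Fintype ι] [DecidableEq ι] (A B : Matrix ι ι ℝ) : Prop :=
  ∃ (P : ℕ → Matrix ι ι ℝ) (d e : ι → ℝ), (∀ k, (P k).det = 1) ∧
    Tendsto (fun k => P k * A * (P k)ᵀ) atTop (𝓝 (diagonal d)) ∧
    Tendsto (fun k => P k * B * (P k)ᵀ) atTop (𝓝 (diagonal e))

/-! ### The pencil determinant and its roots -/

section Pencil

variable {ι κ : Type*} [Fintype ι] [DecidableEq ι] [Fintype κ] [DecidableEq κ]

theorem pencilDet_congr (A B P : Matrix ι ι ℝ) (z : ℂ) :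
    pencilDet (P * A * Pᵀ) (P * B * Pᵀ) z = (P.det : ℂ) ^ 2 * pencilDet A B z := by
  have h : ∀ X : Matrix ι ι ℝ, (P * X * Pᵀ).map Complex.ofReal =
      P.map Complex.ofReal * X.map Complex.ofReal * (P.map Complex.ofReal)ᵀ := by
    intro X
    have hmul : ∀ Y Z : Matrix ι ι ℝ, (Y * Z).map Complex.ofReal =
        Y.map Complex.ofReal * Z.map Complex.ofReal :=
      fun Y Z => Matrix.map_mul (L := Y) (M := Z) (f := Complex.ofRealHom)
    rw [hmul, hmul, Matrix.transpose_map]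
  have hdet : (P.map Complex.ofReal).det = (P.det : ℂ) :=
    (RingHom.map_det Complex.ofRealHom P).symm
  have : z • (P * A * Pᵀ).map Complex.ofReal - (P * B * Pᵀ).map Complex.ofReal =
      P.map Complex.ofReal * (z • A.map Complex.ofReal - B.map Complex.ofReal) *
        (P.map Complex.ofReal)ᵀ := by
    rw [h, h]
    simp [mul_sub, sub_mul]
  rw [pencilDet, this, det_mul, det_mul, det_transpose, hdet, pencilDet]
  ring

theorem pencilDet_submatrix (A B : Matrix ι ι ℝ) (f : κ ≃ ι) (z : ℂ) :
    pencilDet (A.submatrix f f) (B.submatrix f f) z = pencilDet A B z :=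
  det_submatrix_equiv_self f (z • A.map Complex.ofReal - B.map Complex.ofReal)

theorem pencilDet_fromBlocks (A B : Matrix ι ι ℝ) (C D : Matrix κ κ ℝ) (z : ℂ) :
    pencilDet (fromBlocks A 0 0 C) (fromBlocks B 0 0 D) z =
      pencilDet A B z * pencilDet C D z := by
  rw [pencilDet, pencilDet, pencilDet, ← det_fromBlocks_zero₁₂ _ 0]
  congr 1
  ext i j
  rcases i with i | i <;> rcases j with j | j <;> simp

theorem pencilDet_ofReal (A B : Matrix ι ι ℝ) (x : ℝ) :
    pencilDet A B x = ((x • A - B).det : ℝ) := by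
  rw [← Complex.ofRealHom_eq_coe (x • A - B).det, RingHom.map_det, pencilDet]
  congr 1
  ext i j
  simp

theorem continuous_pencilDet (z : ℂ) :
    Continuous fun X : Matrix ι ι ℝ × Matrix ι ι ℝ => pencilDet X.1 X.2 z := by
  unfold pencilDet
  refine Continuous.matrix_det ?_
  exact ((continuous_fst.matrix_map Complex.continuous_ofReal).const_smul z).sub
    (continuous_snd.matrix_map Complex.continuous_ofReal)

theorem pencilDet_eq_of_tendsto {A B A' B' : Matrix ι ι ℝ} {P : ℕ → Matrix ι ι ℝ}
    (hP : ∀ k, (P k).det = 1) (hA : Tendsto (fun k => P k * A * (P k)ᵀ) atTop (𝓝 A'))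
    (hB : Tendsto (fun k => P k * B * (P k)ᵀ) atTop (𝓝 B')) (z : ℂ) :
    pencilDet A' B' z = pencilDet A B z := by
  have h := ((continuous_pencilDet z).tendsto (A', B')).comp (hA.prodMk_nhds hB)
  refine tendsto_nhds_unique h ?_
  simp [Function.comp_def, pencilDet_congr, hP]

theorem det_eq_of_tendsto {A A' : Matrix ι ι ℝ} {P : ℕ → Matrix ι ι ℝ}
    (hP : ∀ k, (P k).det = 1) (hA : Tendsto (fun k => P k * A * (P k)ᵀ) atTop (𝓝 A')) :
    A'.det = A.det := by
  have h := ((continuous_id.matrix_det).tendsto A').comp hA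
  refine tendsto_nhds_unique h ?_
  simp [Function.comp_def, hP]

theorem im_eq_zero_of_pencilDet_diagonal {d e : ι → ℝ} (hd : ∀ i, d i ≠ 0) {z : ℂ}
    (hz : pencilDet (diagonal d) (diagonal e) z = 0) : z.im = 0 := by
  have : z • (diagonal d).map Complex.ofReal - (diagonal e).map Complex.ofReal =
      diagonal fun i => z * (d i : ℂ) - (e i : ℂ) := by
    ext i j
    by_cases h : i = j
    · subst h; simp
    · simp [h]
  rw [pencilDet, this, det_diagonal, Finset.prod_eq_zero_iff] at hz
  obtain ⟨i, -, hi⟩ := hz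
  have := congrArg Complex.im hi
  simpa [hd i] using this

/-- Factoring out A makes the pencil determinant det A times the characteristic polynomial of A⁻¹B.
-/
theorem hasEigenvalue_iff_pencilDet {A : Matrix ι ι ℝ} (hA : A.det ≠ 0) (B : Matrix ι ι ℝ)
    (z : ℂ) :
    Module.End.HasEigenvalue (Matrix.toLin' ((A⁻¹ * B).map Complex.ofReal)) z ↔
      pencilDet A B z = 0 := by
  rw [Module.End.hasEigenvalue_iff_isRoot_charpoly, Polynomial.IsRoot.def,
    Matrix.charpoly_toLin', Matrix.eval_charpoly]
  have hdet : (A.map Complex.ofReal).det = (A.det : ℂ) :=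
    (RingHom.map_det Complex.ofRealHom A).symm
  have hB : B.map Complex.ofReal = A.map Complex.ofReal * (A⁻¹ * B).map Complex.ofReal := by
    have := Matrix.map_mul (L := A) (M := A⁻¹ * B) (f := Complex.ofRealHom)
    rw [← Matrix.mul_assoc, Matrix.mul_nonsing_inv _ (isUnit_iff_ne_zero.2 hA),
      Matrix.one_mul] at this
    exact this
  have h : z • A.map Complex.ofReal - B.map Complex.ofReal =
      A.map Complex.ofReal * (Matrix.scalar ι z - (A⁻¹ * B).map Complex.ofReal) := by
    rw [mul_sub, ← hB]
    simp [← Matrix.smul_one_eq_diagonal]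
  rw [pencilDet, h, det_mul, hdet, mul_eq_zero]
  simp [hA]

theorem exists_pencilDet_eq_zero [Nonempty ι] {A : Matrix ι ι ℝ} (hA : A.det ≠ 0)
    (B : Matrix ι ι ℝ) : ∃ z, pencilDet A B z = 0 := by
  obtain ⟨z, hz⟩ := Module.End.exists_eigenvalue
    (Matrix.toLin' ((A⁻¹ * B).map Complex.ofReal))
  exact ⟨z, (hasEigenvalue_iff_pencilDet hA B z).1 hz⟩

end Pencil

/-! ### Stability of weak diagonalizability -/

section WeaklyDiagonalizable

variable {ι κ : Type*} [Fintype ι] [DecidableEq ι] [Fintype κ] [DecidableEq κ]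

theorem weaklyDiagonalizable_diagonal (d e : ι → ℝ) :
    WeaklyDiagonalizable (diagonal d) (diagonal e) :=
  ⟨fun _ => 1, d, e, by simp, by simp, by simp⟩

theorem WeaklyDiagonalizable.of_submatrix {A B : Matrix ι ι ℝ} (f : κ ≃ ι)
    (h : WeaklyDiagonalizable (A.submatrix f f) (B.submatrix f f)) :
    WeaklyDiagonalizable A B := by
  obtain ⟨P, d, e, hP, hA, hB⟩ := h
  have key : ∀ (X : Matrix ι ι ℝ) (x : κ → ℝ),
      Tendsto (fun k => P k * X.submatrix f f * (P k)ᵀ) atTop (𝓝 (diagonal x)) →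
      Tendsto (fun k => (P k).submatrix f.symm f.symm * X * ((P k).submatrix f.symm f.symm)ᵀ)
        atTop (𝓝 (diagonal (x ∘ f.symm))) := by
    intro X x hX
    have hc : Continuous fun Y : Matrix κ κ ℝ => Y.submatrix f.symm f.symm :=
      continuous_id.matrix_submatrix _ _
    have := (hc.tendsto _).comp hX
    rw [submatrix_diagonal_equiv] at this
    refine this.congr fun k => ?_
    simp only [Function.comp_apply]
    rw [← submatrix_mul_equiv _ _ _ f.symm, ← submatrix_mul_equiv _ _ _ f.symm]
    simp [transpose_submatrix]
  exact ⟨fun k => (P k).submatrix f.symm f.symm, d ∘ f.symm, e ∘ f.symm,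
    fun k => by rw [det_submatrix_equiv_self, hP], key A d hA, key B e hB⟩

theorem exists_det_diagonal_mul_eq_one {c : ℝ} (Q : Matrix ι ι ℝ) (hc : Q.det = c) (h0 : c ≠ 0) :
    ∃ s : ι → ℝ, (diagonal s * Q).det = 1 := by
  rcases isEmpty_or_nonempty ι with h | ⟨⟨i⟩⟩
  · exact ⟨fun _ => 1, by simp⟩
  · refine ⟨Function.update 1 i c⁻¹, ?_⟩
    rw [det_mul, det_diagonal, Finset.prod_update_of_mem (Finset.mem_univ i), hc]
    simp [h0]

/-- A diagonal left factor restores determinant one and keeps the limits diagonal, so any invertible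
change of basis is allowed. -/
theorem WeaklyDiagonalizable.of_congr {A B : Matrix ι ι ℝ} (Q : Matrix ι ι ℝ) (hQ : Q.det ≠ 0)
    (h : WeaklyDiagonalizable (Q * A * Qᵀ) (Q * B * Qᵀ)) : WeaklyDiagonalizable A B := by
  obtain ⟨P, d, e, hP, hA, hB⟩ := h
  obtain ⟨s, hs⟩ := exists_det_diagonal_mul_eq_one Q rfl hQ
  have key : ∀ (X : Matrix ι ι ℝ) (x : ι → ℝ),
      Tendsto (fun k => P k * (Q * X * Qᵀ) * (P k)ᵀ) atTop (𝓝 (diagonal x)) →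
      Tendsto (fun k => (diagonal s * P k * Q) * X * (diagonal s * P k * Q)ᵀ)
        atTop (𝓝 (diagonal fun i => s i * x i * s i)) := by
    intro X x hX
    have hc : Continuous fun Y : Matrix ι ι ℝ => diagonal s * Y * diagonal s := by fun_prop
    have := (hc.tendsto _).comp hX
    rw [diagonal_mul_diagonal, diagonal_mul_diagonal] at this
    refine this.congr fun k => ?_
    simp [Function.comp_apply, Matrix.mul_assoc]
  refine ⟨fun k => diagonal s * P k * Q, _, _, fun k => ?_, key A d hA, key B e hB⟩
  rw [det_mul, det_mul, hP, mul_one, ← det_mul, hs]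

theorem WeaklyDiagonalizable.fromBlocks {A B : Matrix ι ι ℝ} {C D : Matrix κ κ ℝ}
    (h₁ : WeaklyDiagonalizable A B) (h₂ : WeaklyDiagonalizable C D) :
    WeaklyDiagonalizable (fromBlocks A 0 0 C) (fromBlocks B 0 0 D) := by
  obtain ⟨P, d, e, hP, hA, hB⟩ := h₁
  obtain ⟨Q, d', e', hQ, hC, hD⟩ := h₂
  have key : ∀ (X : Matrix ι ι ℝ) (Y : Matrix κ κ ℝ) (x : ι → ℝ) (y : κ → ℝ),
      Tendsto (fun k => P k * X * (P k)ᵀ) atTop (𝓝 (diagonal x)) →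
      Tendsto (fun k => Q k * Y * (Q k)ᵀ) atTop (𝓝 (diagonal y)) →
      Tendsto (fun k => Matrix.fromBlocks (P k) 0 0 (Q k) * Matrix.fromBlocks X 0 0 Y *
        (Matrix.fromBlocks (P k) 0 0 (Q k))ᵀ) atTop (𝓝 (diagonal (Sum.elim x y))) := by
    intro X Y x y hx hy
    have hc : Continuous fun Z : Matrix ι ι ℝ × Matrix κ κ ℝ =>
        Matrix.fromBlocks Z.1 0 0 Z.2 :=
      continuous_fst.matrix_fromBlocks continuous_const continuous_const continuous_snd
    have := (hc.tendsto _).comp (hx.prodMk_nhds hy)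
    rw [fromBlocks_diagonal] at this
    refine this.congr fun k => ?_
    simp [fromBlocks_multiply, fromBlocks_transpose]
  exact ⟨fun k => Matrix.fromBlocks (P k) 0 0 (Q k), _, _, fun k => by simp [hP, hQ],
    key A C d d' hA hC, key B D e e' hB hD⟩

theorem WeaklyDiagonalizable.of_tendsto {A B A' B' : Matrix ι ι ℝ} {P : ℕ → Matrix ι ι ℝ}
    (hP : ∀ k, (P k).det = 1) (hA : Tendsto (fun k => P k * A * (P k)ᵀ) atTop (𝓝 A'))
    (hB : Tendsto (fun k => P k * B * (P k)ᵀ) atTop (𝓝 B'))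
    (h : WeaklyDiagonalizable A' B') : WeaklyDiagonalizable A B := by
  obtain ⟨Q, d, e, hQ, hd, he⟩ := h
  let orbit : Set (Matrix ι ι ℝ × Matrix ι ι ℝ) :=
    {X | ∃ R : Matrix ι ι ℝ, R.det = 1 ∧ (R * A * Rᵀ, R * B * Rᵀ) = X}
  have hmem : (diagonal d, diagonal e) ∈ closure orbit := by
    -- Each term of the outer sequence is itself a limit of orbit points, so idempotence of closure
    -- replaces a diagonal-sequence argument.
    rw [← closure_closure]
    refine mem_closure_of_tendsto (hd.prodMk_nhds he) (Eventually.of_forall fun k => ?_)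
    have hc : Continuous fun X : Matrix ι ι ℝ × Matrix ι ι ℝ =>
        (Q k * X.1 * (Q k)ᵀ, Q k * X.2 * (Q k)ᵀ) := by fun_prop
    refine mem_closure_of_tendsto ((hc.tendsto _).comp (hA.prodMk_nhds hB))
      (Eventually.of_forall fun l => ⟨Q k * P l, by simp [hQ, hP], ?_⟩)
    simp [Matrix.mul_assoc]
  have : FirstCountableTopology (Matrix ι ι ℝ) :=
    inferInstanceAs (FirstCountableTopology (ι → ι → ℝ))
  obtain ⟨X, hX, hlim⟩ := mem_closure_iff_seq_limit.1 hmem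
  choose R hR hRX using hX
  rw [Prod.tendsto_iff] at hlim
  refine ⟨R, d, e, hR, hlim.1.congr fun k => ?_, hlim.2.congr fun k => ?_⟩
  · rw [← hRX]
  · rw [← hRX]

end WeaklyDiagonalizable

/-! ### Pairs with real roots and their eigenvectors -/

section Induction

variable {ι κ : Type*} [Fintype ι] [DecidableEq ι] [Fintype κ] [DecidableEq κ]

/-- A regular symmetric pair whose pencil has only real roots. -/
structure IsRealPair (A B : Matrix ι ι ℝ) : Prop where
  symm_left : A.IsSymm
  symm_right : B.IsSymm
  det_ne_zero : A.det ≠ 0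
  real_roots : ∀ z, pencilDet A B z = 0 → z.im = 0

theorem IsRealPair.congr {A B : Matrix ι ι ℝ} (h : IsRealPair A B) {Q : Matrix ι ι ℝ}
    (hQ : Q.det ≠ 0) : IsRealPair (Q * A * Qᵀ) (Q * B * Qᵀ) where
  symm_left := by
    simp [IsSymm, Matrix.mul_assoc, h.symm_left.eq]
  symm_right := by
    simp [IsSymm, Matrix.mul_assoc, h.symm_right.eq]
  det_ne_zero := by
    simp [hQ, h.det_ne_zero]
  real_roots z hz := by
    rw [pencilDet_congr] at hz
    exact h.real_roots z (by simpa [hQ] using hz)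

theorem IsRealPair.submatrix {A B : Matrix ι ι ℝ} (h : IsRealPair A B) (f : κ ≃ ι) :
    IsRealPair (A.submatrix f f) (B.submatrix f f) where
  symm_left := h.symm_left.submatrix f
  symm_right := h.symm_right.submatrix f
  det_ne_zero := by rw [det_submatrix_equiv_self]; exact h.det_ne_zero
  real_roots z hz := h.real_roots z (by rwa [pencilDet_submatrix] at hz)

theorem IsRealPair.of_fromBlocks {A B : Matrix ι ι ℝ} {C D : Matrix κ κ ℝ}
    (h : IsRealPair (fromBlocks A 0 0 C) (fromBlocks B 0 0 D)) : IsRealPair C D where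
  symm_left := (isSymm_fromBlocks_iff.1 h.symm_left).2.2.2
  symm_right := (isSymm_fromBlocks_iff.1 h.symm_right).2.2.2
  det_ne_zero := by
    have := h.det_ne_zero
    rw [det_fromBlocks_zero₁₂] at this
    exact right_ne_zero_of_mul this
  real_roots z hz := h.real_roots z (by rw [pencilDet_fromBlocks, hz, mul_zero])

theorem IsRealPair.of_tendsto {A B A' B' : Matrix ι ι ℝ} (h : IsRealPair A B)
    {P : ℕ → Matrix ι ι ℝ} (hP : ∀ k, (P k).det = 1)
    (hA : Tendsto (fun k => P k * A * (P k)ᵀ) atTop (𝓝 A'))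
    (hB : Tendsto (fun k => P k * B * (P k)ᵀ) atTop (𝓝 B')) : IsRealPair A' B' where
  symm_left := by
    refine tendsto_nhds_unique (((continuous_id.matrix_transpose).tendsto A').comp hA)
      (hA.congr fun k => ?_)
    simp [Matrix.mul_assoc, h.symm_left.eq]
  symm_right := by
    refine tendsto_nhds_unique (((continuous_id.matrix_transpose).tendsto B').comp hB)
      (hB.congr fun k => ?_)
    simp [Matrix.mul_assoc, h.symm_right.eq]
  det_ne_zero := by rw [det_eq_of_tendsto hP hA]; exact h.det_ne_zero
  real_roots z hz := h.real_roots z (by rwa [pencilDet_eq_of_tendsto hP hA hB] at hz)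

theorem exists_det_ne_zero_mulVec_eq {v w : ι → ℝ} (hv : v ≠ 0) (hw : w ≠ 0) :
    ∃ Q : Matrix ι ι ℝ, Q.det ≠ 0 ∧ Q *ᵥ v = w := by
  obtain ⟨f, hf⟩ := SeparatingDual.exists_continuousLinearEquiv_apply_eq (R := ℝ) hv hw
  refine ⟨LinearMap.toMatrix' f.toLinearEquiv.toLinearMap, ?_, ?_⟩
  · rw [LinearMap.det_toMatrix']
    exact f.toLinearEquiv.isUnit_det'.ne_zero
  · rw [LinearMap.toMatrix'_mulVec]
    exact hf

theorem IsRealPair.exists_eigenvector [Nonempty ι] {A B : Matrix ι ι ℝ} (h : IsRealPair A B) :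
    ∃ (x : ℝ) (v : ι → ℝ), v ≠ 0 ∧ B *ᵥ v = x • (A *ᵥ v) := by
  obtain ⟨z, hz⟩ := exists_pencilDet_eq_zero h.det_ne_zero B
  obtain ⟨x, rfl⟩ : ∃ x : ℝ, z = x := ⟨z.re, Complex.ext rfl (by simp [h.real_roots z hz])⟩
  rw [pencilDet_ofReal, Complex.ofReal_eq_zero] at hz
  obtain ⟨v, hv, hv'⟩ := exists_mulVec_eq_zero_iff.2 hz
  refine ⟨x, v, hv, ?_⟩
  rw [sub_mulVec, smul_mulVec, sub_eq_zero] at hv'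
  exact hv'.symm

/-- A real pair is congruent to one whose `i`-th columns are proportional. -/
theorem IsRealPair.exists_congr_col {A B : Matrix ι ι ℝ} (h : IsRealPair A B) (i : ι) :
    ∃ (x : ℝ) (Q : Matrix ι ι ℝ), Q.det ≠ 0 ∧
      ∀ j, (Q * B * Qᵀ) j i = x * (Q * A * Qᵀ) j i := by
  have : Nonempty ι := ⟨i⟩
  obtain ⟨x, v, hv, hBv⟩ := h.exists_eigenvector
  obtain ⟨Q, hQ, hQv⟩ := exists_det_ne_zero_mulVec_eq
    (v := Pi.single i (1 : ℝ)) (by simp) hv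
  refine ⟨x, Qᵀ, by rwa [det_transpose], fun j => ?_⟩
  have hcol : ∀ X : Matrix ι ι ℝ, (Qᵀ * X * Qᵀᵀ) j i = (Qᵀ *ᵥ (X *ᵥ v)) j := by
    intro X
    rw [← hQv, mulVec_mulVec, mulVec_mulVec, mulVec_single_one, transpose_transpose, col_apply]
  rw [hcol, hcol, hBv, mulVec_smul, Pi.smul_apply, smul_eq_mul]

end Induction

/-! ### Reduction steps and induction on the size -/

section Steps

variable {κ : Type*} [Fintype κ] [DecidableEq κ]

theorem unit_matrix_eq_diagonal (X : Matrix Unit Unit ℝ) : X = diagonal fun _ => X () () := by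
  ext ⟨⟩ ⟨⟩
  simp

/-- The first block columns are proportional, so the same elimination yields Schur complements of
both matrices. -/
theorem weaklyDiagonalizable_of_anisotropic {a : Matrix Unit Unit ℝ} (ha : a () () ≠ 0)
    {b : Matrix κ Unit ℝ} {D E : Matrix κ κ ℝ} {x : ℝ}
    (h : IsRealPair (fromBlocks a bᵀ b D) (fromBlocks (x • a) (x • bᵀ) (x • b) E))
    (ih : ∀ C F : Matrix κ κ ℝ, IsRealPair C F → WeaklyDiagonalizable C F) :
    WeaklyDiagonalizable (fromBlocks a bᵀ b D) (fromBlocks (x • a) (x • bᵀ) (x • b) E) := by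
  let t := a () ()
  have hat : a = t • 1 := by ext ⟨⟩ ⟨⟩; simp [t]
  have ht : t ≠ 0 := ha
  let Q : Matrix (Unit ⊕ κ) (Unit ⊕ κ) ℝ := fromBlocks 1 0 (-(t⁻¹ • b)) 1
  have hQ : Q.det ≠ 0 := by simp [Q]
  have hQA : Q * fromBlocks a bᵀ b D * Qᵀ = fromBlocks a 0 0 (D - t⁻¹ • (b * bᵀ)) := by
    simp [Q, fromBlocks_multiply, fromBlocks_transpose, hat, ht, sub_eq_neg_add, smul_smul]
  have hQB : Q * fromBlocks (x • a) (x • bᵀ) (x • b) E * Qᵀ =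
      fromBlocks (x • a) 0 0 (E - (x * t⁻¹) • (b * bᵀ)) := by
    simp [Q, fromBlocks_multiply, fromBlocks_transpose, hat, ht, sub_eq_neg_add, smul_smul,
      mul_comm]
  have h' := h.congr hQ
  refine WeaklyDiagonalizable.of_congr Q hQ ?_
  rw [hQA, hQB] at h' ⊢
  refine WeaklyDiagonalizable.fromBlocks ?_ (ih _ _ h'.of_fromBlocks)
  rw [unit_matrix_eq_diagonal a, unit_matrix_eq_diagonal (x • _)]
  exact weaklyDiagonalizable_diagonal _ _

theorem weaklyDiagonalizable_hyperbolic (x : ℝ) :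
    WeaklyDiagonalizable (fromBlocks 0 1 1 0 : Matrix (Unit ⊕ Unit) (Unit ⊕ Unit) ℝ)
      (fromBlocks 0 (x • 1) (x • 1) 0) := by
  -- Up to scale this is the rotation by 45°, turning 2uv into a difference of squares.
  have hdet : (fromBlocks 1 1 (-1) 1 : Matrix (Unit ⊕ Unit) (Unit ⊕ Unit) ℝ).det ≠ 0 := by
    rw [det_fromBlocks_one₁₁]
    simp
  refine WeaklyDiagonalizable.of_congr _ hdet ?_
  have h1 : (fromBlocks 1 1 (-1) 1 * fromBlocks 0 1 1 0 * (fromBlocks 1 1 (-1) 1)ᵀ :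
      Matrix (Unit ⊕ Unit) (Unit ⊕ Unit) ℝ) = diagonal (Sum.elim (fun _ => 2) fun _ => -2) := by
    rw [← fromBlocks_diagonal, fromBlocks_transpose, fromBlocks_multiply, fromBlocks_multiply]
    congr 1 <;> ext ⟨⟩ ⟨⟩ <;> simp <;> norm_num
  have h2 : (fromBlocks 1 1 (-1) 1 * fromBlocks 0 (x • 1) (x • 1) 0 *
      (fromBlocks 1 1 (-1) 1)ᵀ : Matrix (Unit ⊕ Unit) (Unit ⊕ Unit) ℝ) =
      diagonal (Sum.elim (fun _ => 2 * x) fun _ => -2 * x) := by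
    rw [← fromBlocks_diagonal, fromBlocks_transpose, fromBlocks_multiply, fromBlocks_multiply]
    congr 1 <;> ext ⟨⟩ ⟨⟩ <;> simp <;> ring
  rw [h1, h2]
  exact weaklyDiagonalizable_diagonal _ _

/-- The scaling of a hyperbolic pair of basis vectors. -/
noncomputable def hyperbolicScaling (κ : Type*) [DecidableEq κ] (k : ℕ) :
    Matrix ((Unit ⊕ Unit) ⊕ κ) ((Unit ⊕ Unit) ⊕ κ) ℝ :=
  diagonal (Sum.elim (Sum.elim (fun _ => (k : ℝ) + 1) fun _ => ((k : ℝ) + 1)⁻¹) fun _ => 1)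

theorem det_hyperbolicScaling (k : ℕ) : (hyperbolicScaling κ k).det = 1 := by
  have : (k : ℝ) + 1 ≠ 0 := by positivity
  simp [hyperbolicScaling, this]

/-- Give the basis vectors weights 1, -1 and 0. An entry scales by k + 1 to the sum of its two
weights: positive sums occur only at entries assumed zero, sum 0 is fixed, negative sums tend to 0.
-/
theorem tendsto_hyperbolicScaling {X : Matrix ((Unit ⊕ Unit) ⊕ κ) ((Unit ⊕ Unit) ⊕ κ) ℝ}
    (hX : X.IsSymm) {x : ℝ} (h₁ : X (.inl (.inl ())) (.inl (.inl ())) = 0)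
    (h₂ : X (.inl (.inr ())) (.inl (.inl ())) = x)
    (h₃ : ∀ j, X (.inr j) (.inl (.inl ())) = 0) :
    Tendsto (fun k => hyperbolicScaling κ k * X * (hyperbolicScaling κ k)ᵀ) atTop
      (𝓝 (fromBlocks (fromBlocks 0 (x • 1) (x • 1) 0) 0 0 X.toBlocks₂₂)) := by
  have hs : Tendsto (fun k : ℕ => ((k : ℝ) + 1)⁻¹) atTop (𝓝 0) := by
    simpa using tendsto_one_div_add_atTop_nhds_zero_nat (𝕜 := ℝ)
  have hne : ∀ k : ℕ, (k : ℝ) + 1 ≠ 0 := fun k => by positivity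
  have h₂' := hX.apply (.inl (.inr ())) (.inl (.inl ()))
  have h₃' := fun j => hX.apply (.inr j) (.inl (.inl ()))
  rw [h₂] at h₂'
  simp only [h₃] at h₃'
  refine tendsto_pi_nhds.2 fun i => tendsto_pi_nhds.2 fun j => ?_
  simp only [hyperbolicScaling, diagonal_transpose, mul_diagonal, diagonal_mul]
  rcases i with (⟨⟨⟩⟩ | ⟨⟨⟩⟩) | i <;> rcases j with (⟨⟨⟩⟩ | ⟨⟨⟩⟩) | j
  · simp [h₁]
  · simpa [h₂'] using tendsto_const_nhds.congr fun k : ℕ =>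
      (show x = ((k : ℝ) + 1) * x * ((k : ℝ) + 1)⁻¹ by field_simp [hne k])
  · simp [h₃']
  · simpa [h₂] using tendsto_const_nhds.congr fun k : ℕ =>
      (show x = ((k : ℝ) + 1)⁻¹ * x * ((k : ℝ) + 1) by field_simp [hne k])
  · simpa using (hs.mul_const _).mul hs
  · simpa using hs.mul_const _
  · simp [h₃]
  · simpa using hs.const_mul _
  · simp [toBlocks₂₂]

theorem weaklyDiagonalizable_of_isotropic
    {A B : Matrix ((Unit ⊕ Unit) ⊕ κ) ((Unit ⊕ Unit) ⊕ κ) ℝ} (h : IsRealPair A B) {x : ℝ}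
    (h₁ : A (.inl (.inl ())) (.inl (.inl ())) = 0)
    (h₂ : A (.inl (.inr ())) (.inl (.inl ())) = 1)
    (h₃ : ∀ j, A (.inr j) (.inl (.inl ())) = 0)
    (hB : ∀ j, B j (.inl (.inl ())) = x * A j (.inl (.inl ())))
    (ih : ∀ C F : Matrix κ κ ℝ, IsRealPair C F → WeaklyDiagonalizable C F) :
    WeaklyDiagonalizable A B := by
  have hA' := tendsto_hyperbolicScaling h.symm_left h₁ h₂ h₃
  have hB' := tendsto_hyperbolicScaling (x := x) h.symm_right (by simp [hB, h₁])
    (by simp [hB, h₂]) (by simp [hB, h₃])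
  refine WeaklyDiagonalizable.of_tendsto det_hyperbolicScaling hA' hB' ?_
  refine WeaklyDiagonalizable.fromBlocks ?_
    (ih _ _ (h.of_tendsto det_hyperbolicScaling hA' hB').of_fromBlocks)
  rw [one_smul]
  exact weaklyDiagonalizable_hyperbolic x

theorem IsRealPair.weaklyDiagonalizable_of_card {n : ℕ} :
    ∀ {ι : Type} [Fintype ι] [DecidableEq ι], Fintype.card ι = n →
      ∀ A B : Matrix ι ι ℝ, IsRealPair A B → WeaklyDiagonalizable A B := by
  -- Strong induction, since the isotropic step lowers the size by two.
  induction n using Nat.strong_induction_on with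
  | _ n ih =>
  intro ι _ _ hn A₀ B₀ h₀
  rcases n with _ | n
  · have := Fintype.card_eq_zero_iff.1 hn
    rw [Subsingleton.elim A₀ (diagonal 0), Subsingleton.elim B₀ (diagonal 0)]
    exact weaklyDiagonalizable_diagonal _ _
  let f : Unit ⊕ Fin n ≃ ι := Fintype.equivOfCardEq (by simp [hn, add_comm])
  obtain ⟨x, Q, hQ, hcol⟩ := (h₀.submatrix f).exists_congr_col (.inl ())
  refine .of_submatrix f (.of_congr Q hQ ?_)
  have h := (h₀.submatrix f).congr hQ
  generalize Q * A₀.submatrix f f * Qᵀ = A at h hcol ⊢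
  generalize Q * B₀.submatrix f f * Qᵀ = B at h hcol ⊢
  clear h₀ hQ Q f hn A₀ B₀
  by_cases ha : A (.inl ()) (.inl ()) = 0
  · let b : Fin n → ℝ := fun j => A (.inr j) (.inl ())
    have hb : b ≠ 0 := by
      intro hb
      refine h.det_ne_zero (det_eq_zero_of_column_eq_zero (.inl ()) ?_)
      rintro (⟨⟨⟩⟩ | j)
      · exact ha
      · exact congrFun hb j
    obtain ⟨m, rfl⟩ : ∃ m, n = m + 1 := by
      rcases n with _ | m
      · exact absurd (Subsingleton.elim _ _) hb
      · exact ⟨m, rfl⟩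
    obtain ⟨R, hR, hRb⟩ := exists_det_ne_zero_mulVec_eq (w := Pi.single 0 (1 : ℝ)) hb (by simp)
    let Q : Matrix (Unit ⊕ Fin (m + 1)) (Unit ⊕ Fin (m + 1)) ℝ := fromBlocks 1 0 0 R
    have hQ : Q.det ≠ 0 := by simpa [Q] using hR
    -- `g` sends the `Unit` summand to index 0, where R *ᵥ b has its only nonzero entry; this index
    -- becomes the hyperbolic partner.
    let g : Unit ⊕ Fin m ≃ Fin (m + 1) := (Equiv.sumComm _ _).trans
      ((Equiv.optionEquivSumPUnit (Fin m)).symm.trans (finSuccEquiv m).symm)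
    let f : (Unit ⊕ Unit) ⊕ Fin m ≃ Unit ⊕ Fin (m + 1) :=
      (Equiv.sumAssoc _ _ _).trans ((Equiv.refl _).sumCongr g)
    have hent₁ : ∀ X : Matrix (Unit ⊕ Fin (m + 1)) (Unit ⊕ Fin (m + 1)) ℝ,
        (Q * X * Qᵀ) (.inl ()) (.inl ()) = X (.inl ()) (.inl ()) := by
      intro X
      simp [Q, Matrix.mul_apply]
    have hent₂ : ∀ (X : Matrix (Unit ⊕ Fin (m + 1)) (Unit ⊕ Fin (m + 1)) ℝ) j,
        (Q * X * Qᵀ) (.inr j) (.inl ()) = (R *ᵥ fun l => X (.inr l) (.inl ())) j := by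
      intro X j
      simp [Q, Matrix.mul_apply, mulVec, dotProduct]
    have hent : ∀ j, (Q * B * Qᵀ) j (.inl ()) = x * (Q * A * Qᵀ) j (.inl ()) := by
      rintro (⟨⟨⟩⟩ | j)
      · rw [hent₁, hent₁, hcol]
      · rw [hent₂, hent₂, ← smul_eq_mul, ← Pi.smul_apply, ← mulVec_smul]
        simp only [hcol]
        rfl
    refine .of_congr Q hQ (.of_submatrix f ?_)
    refine weaklyDiagonalizable_of_isotropic (x := x) ((h.congr hQ).submatrix f) ?_ ?_ ?_ ?_
      (ih m (by omega) (by simp))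
    · exact (hent₁ A).trans ha
    · refine (hent₂ A (g (.inl ()))).trans ?_
      change (R *ᵥ b) _ = 1
      rw [hRb]
      simp [g]
    · intro j
      refine (hent₂ A (g (.inr j))).trans ?_
      change (R *ᵥ b) _ = 0
      rw [hRb]
      simp [g]
    · intro j
      exact hent (f j)
  · have hB : ∀ j, B (.inl ()) j = x * A (.inl ()) j := by
      intro j
      rw [← h.symm_right.apply, ← h.symm_left.apply, hcol]
    have hA' : A = fromBlocks A.toBlocks₁₁ A.toBlocks₂₁ᵀ A.toBlocks₂₁ A.toBlocks₂₂ := by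
      ext (i | i) (j | j) <;> simp [toBlocks₁₁, toBlocks₂₁, toBlocks₂₂, h.symm_left.apply]
    have hB' : B = fromBlocks (x • A.toBlocks₁₁) (x • A.toBlocks₂₁ᵀ) (x • A.toBlocks₂₁)
        B.toBlocks₂₂ := by
      ext (i | i) (j | j) <;>
        simp [toBlocks₁₁, toBlocks₂₁, toBlocks₂₂, h.symm_left.apply, hB, hcol]
    rw [hA', hB'] at h ⊢
    exact weaklyDiagonalizable_of_anisotropic ha h (ih n (by omega) (by simp))

end Steps

/-! ### TWSD-B versus weak diagonalizability -/

section FrobeniusNorm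

open scoped Matrix.Norms.Frobenius

theorem WeaklyDiagonalizable.isTWSDB {m : ℕ} {A B : Matrix (Fin m) (Fin m) ℝ}
    (h : WeaklyDiagonalizable A B) : IsTWSDB ![A, B] := by
  obtain ⟨P, d, e, hP, hA, hB⟩ := h
  refine ⟨fun k => ⟨P k, hP k⟩, fun _ => ![diagonal d, diagonal e], ?_, ?_,
    max ‖diagonal d‖ ‖diagonal e‖, ?_⟩
  · intro k i
    fin_cases i <;> simp [isDiag_diagonal]
  · have h1 := (tendsto_iff_norm_sub_tendsto_zero.1 hA).pow 2
    have h2 := (tendsto_iff_norm_sub_tendsto_zero.1 hB).pow 2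
    simpa [phiT] using h1.add h2
  · intro k i
    fin_cases i <;> simp

theorem IsTWSDB.weaklyDiagonalizable {m : ℕ} {A B : Matrix (Fin m) (Fin m) ℝ}
    (h : IsTWSDB ![A, B]) : WeaklyDiagonalizable A B := by
  obtain ⟨P, D, hD, hlim, M, hM⟩ := h
  have hnorm : ∀ i, Tendsto (fun k => (P k).1 * (![A, B] i) * (P k).1ᵀ - D k i) atTop (𝓝 0) := by
    intro i
    refine tendsto_zero_iff_norm_tendsto_zero.2 ?_
    have hsq : Tendsto (fun k => ‖(P k).1 * (![A, B] i) * (P k).1ᵀ - D k i‖ ^ 2) atTop (𝓝 0) :=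
      squeeze_zero (fun _ => by positivity) (fun k => Finset.single_le_sum
        (f := fun i => ‖(P k).1 * (![A, B] i) * (P k).1ᵀ - D k i‖ ^ 2)
        (fun _ _ => by positivity) (Finset.mem_univ i)) hlim
    simpa [Real.sqrt_sq] using hsq.sqrt
  have : ProperSpace (Matrix (Fin m) (Fin m) ℝ) := FiniteDimensional.proper ℝ _
  -- Boundedness of the D k is used here: along a subsequence both converge, and the transformed
  -- matrices then share their diagonal limits.
  obtain ⟨L, -, φ, hφ, hL⟩ := tendsto_subseq_of_bounded
    (s := {X : Matrix (Fin m) (Fin m) ℝ × Matrix (Fin m) (Fin m) ℝ | ‖X‖ ≤ M})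
    (isBounded_iff_forall_norm_le.2 ⟨M, fun _ h => h⟩) (x := fun k => (D k 0, D k 1))
    (fun k => by simpa [Prod.norm_def] using ⟨hM k 0, hM k 1⟩)
  rw [Prod.tendsto_iff] at hL
  have hdiag : ∀ (i : Fin 2) (X : Matrix (Fin m) (Fin m) ℝ),
      Tendsto (fun k => D (φ k) i) atTop (𝓝 X) → X = diagonal X.diag := by
    intro i X hX
    refine (tendsto_nhds_unique (((continuous_id.matrix_diag.matrix_diagonal).tendsto X).comp hX)
      (hX.congr fun k => ?_)).symm
    exact ((hD (φ k) i).diagonal_diag).symm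
  have key : ∀ (i : Fin 2) (X : Matrix (Fin m) (Fin m) ℝ),
      Tendsto (fun k => D (φ k) i) atTop (𝓝 X) →
      Tendsto (fun k => (P (φ k)).1 * (![A, B] i) * (P (φ k)).1ᵀ) atTop (𝓝 (diagonal X.diag)) := by
    intro i X hX
    rw [← hdiag i X hX]
    simpa using ((hnorm i).comp hφ.tendsto_atTop).add hX
  exact ⟨fun k => (P (φ k)).1, _, _, fun k => (P (φ k)).2, key 0 _ hL.1, key 1 _ hL.2⟩

end FrobeniusNorm

theorem WeaklyDiagonalizable.im_eq_zero {ι : Type*} [Fintype ι] [DecidableEq ι]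
    {A B : Matrix ι ι ℝ} (h : WeaklyDiagonalizable A B) (hA : A.det ≠ 0) {z : ℂ}
    (hz : pencilDet A B z = 0) : z.im = 0 := by
  obtain ⟨P, d, e, hP, hd, he⟩ := h
  refine im_eq_zero_of_pencilDet_diagonal (d := d) (e := e) (fun i hi => hA ?_)
    ((pencilDet_eq_of_tendsto hP hd he z).trans hz)
  rw [← det_eq_of_tendsto hP hd, det_diagonal]
  exact Finset.prod_eq_zero (Finset.mem_univ i) hi

theorem mainTheorem1 (m : ℕ) (A B : Matrix (Fin m) (Fin m) ℝ)
    (hA : A.IsSymm) (hB : B.IsSymm) (hdet : A.det ≠ 0) :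
    IsTWSDB ![A, B] ↔ HasOnlyRealEigenvalues (A⁻¹ * B) := by
  simp only [HasOnlyRealEigenvalues, hasEigenvalue_iff_pencilDet hdet]
  exact ⟨fun h z hz => h.weaklyDiagonalizable.im_eq_zero hdet hz, fun h =>
    (IsRealPair.weaklyDiagonalizable_of_card rfl A B ⟨hA, hB, hdet, h⟩).isTWSDB⟩
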